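/- For a nonnegative Borel measure $\mu$ on $\mathbb R^n$ and $0<\beta<n$ let $\mathbf I_{\beta}\mu(x)=\int_{\mathbb R^n}|x-y|^{\beta-n}\,d\mu(y)\in[0,\infty]$ be its Riesz potential. Let $0<q<1$, $0<\alpha<\frac n2$, $0<r<\infty$, and let $\sigma\not\equiv0$ be a nonnegative Radon measure on $\mathbb R^n$. A function $u:\mathbb R^n\to[0,\infty]$ with $u\in L^q_{\rm loc}(\mathbb R^n,d\sigma)$ is called a solution of $(-\Delta)^\alpha u=\sigma u^q$ in $\mathbb R^n$ if $u=\mathbf I_{2\alpha}(u^q\,d\sigma)$ everywhere in $\mathbb R^n$, and a supersolution if $u\ge\mathbf I_{2\alpha}(u^q\,d\sigma)$ everywhere in $\mathbb R^n$. (i) Suppose that $r>\frac{n}{n-2\alpha}$ and $\mathbf I_{2\alpha}\sigma\in L^{\frac{\gamma+q}{1-q}}(\mathbb R^n,d\sigma)$, where $\gamma=\frac{r(n-2\alpha)-n}{n}$. Then there exists a solution $u\in L^r(\mathbb R^n)$ that is positive everywhere in $\mathbb{R}^n$; moreover $\liminf_{x\to\infty}u(x)=0$. (ii) If $0<r\le\frac{n}{n-2\alpha}$,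 then there are only trivial supersolutions in $L^r(\mathbb R^n)$: every supersolution $u\in L^r(\mathbb R^n)$ vanishes $\sigma$-almost everywhere (that is, $u^q\,d\sigma=0$). If moreover $u$ is a solution, or more generally if $u\in L^r(\mathbb{R}^n)\cap L^q_{\rm loc}(\mathbb{R}^n,d\sigma)$ and $u=\mathbf I_{2\alpha}\omega$ everywhere for some Radon measure $\omega\ge u^q\,d\sigma$, then $u=0$ everywhere in $\mathbb R^n$. -/

import Mathlib

open MeasureTheory Filter
open scoped ENNReal

noncomputable section

/-- The Riesz potential `I_β μ (x) = ∫ |x - y|^(β - n) dμ(y)` of order `β` of a measure on `ℝⁿ`,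
with values in `[0, ∞]`; for `β < n` the kernel is `+∞` on the diagonal. -/
def rieszPotential {n : ℕ} (β : ℝ) (μ : Measure (EuclideanSpace ℝ (Fin n)))
    (x : EuclideanSpace ℝ (Fin n)) : ℝ≥0∞ :=
  ∫⁻ y, edist x y ^ (β - n) ∂μ

/-- The measure `u^q dσ`. -/
def powMeasure {n : ℕ} (u : EuclideanSpace ℝ (Fin n) → ℝ≥0∞) (q : ℝ)
    (σ : Measure (EuclideanSpace ℝ (Fin n))) : Measure (EuclideanSpace ℝ (Fin n)) :=
  σ.withDensity (fun y => u y ^ q)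

/-- `u ∈ L^q_loc(ℝⁿ, dσ)`: `u` is in `L^q(K, dσ)` for every compact set `K`. -/
def MemLpLoc {n : ℕ} (u : EuclideanSpace ℝ (Fin n) → ℝ≥0∞) (q : ℝ)
    (σ : Measure (EuclideanSpace ℝ (Fin n))) : Prop :=
  ∀ K : Set (EuclideanSpace ℝ (Fin n)), IsCompact K →
    MemLp u (ENNReal.ofReal q) (σ.restrict K)

/-- `u ≥ 0` solves `(-Δ)^α u = σ u^q` in `ℝⁿ`, understood as the integral equation
`u = I_{2α}(u^q dσ)` at every point, with `u ∈ L^q_loc(dσ)`. -/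
structure IsSolution {n : ℕ} (α q : ℝ) (σ : Measure (EuclideanSpace ℝ (Fin n)))
    (u : EuclideanSpace ℝ (Fin n) → ℝ≥0∞) : Prop where
  memLpLoc : MemLpLoc u q σ
  eq_potential : ∀ x, u x = rieszPotential (2 * α) (powMeasure u q σ) x

/-- `u ≥ 0` is a supersolution of the integral equation: `u ≥ I_{2α}(u^q dσ)` at every point,
with `u ∈ L^q_loc(dσ)`. -/
structure IsSupersolution {n : ℕ} (α q : ℝ) (σ : Measure (EuclideanSpace ℝ (Fin n)))
    (u : EuclideanSpace ℝ (Fin n) → ℝ≥0∞) : Prop where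
  memLpLoc : MemLpLoc u q σ
  potential_le : ∀ x, rieszPotential (2 * α) (powMeasure u q σ) x ≤ u x

/-- `u ≥ 0` satisfies `(-Δ)^α u ≥ σ u^q` in `ℝⁿ`, in the sense that `u ∈ L^q_loc(dσ)` and
`u = I_{2α} ω` for some Radon measure `ω ≥ u^q dσ`. -/
structure IsPotentialSupersolution {n : ℕ} (α q : ℝ) (σ : Measure (EuclideanSpace ℝ (Fin n)))
    (u : EuclideanSpace ℝ (Fin n) → ℝ≥0∞) : Prop where
  memLpLoc : MemLpLoc u q σ
  exists_measure : ∃ ω : Measure (EuclideanSpace ℝ (Fin n)), IsLocallyFiniteMeasure ω ∧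
    powMeasure u q σ ≤ ω ∧ ∀ x, u x = rieszPotential (2 * α) ω x

end

/-! ### Layer cake formula on `[0, ∞]`. -/

section General

variable {X : Type*} [MeasurableSpace X]

/-! Put `β = 2α`, `K = I_β σ`, `s = γ + q`.

Existence is monotone iteration of `f ↦ I_β(f^q dσ)` from a small multiple of `K^(1/(1-q))`. That
start is a subsolution because `K^(1+a) ≤ C I_β(K^a dσ)`, a consequence of the weak maximum
principle. The iterates stay bounded in `L^s(σ)`: `I_β(g dσ) / K` is dominated by the centred
maximal function of `g dσ` relative to `σ`, bounded on `L^p(σ)` for `p > 1` by Besicovitch covering,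
and Hölder's inequality with `K ∈ L^(s/(1-q))(σ)` gives `∫ (I_β(f^q dσ))^s dσ ≤ C (∫ f^s dσ)^q`,
where `q < 1` closes the induction.

The limit is `u = I_β μ` with `μ = u^q dσ`, and its energy `∫ u^γ dμ = ∫ u^s dσ` is finite. By the
maximum principle, where `u` is large compared with `t`, at least half of it comes from `μ`
restricted to `{u > t}`. The weak type `(1, n/(n-β))` bound for that restriction, integrated over
`t`, turns finite energy into `u ∈ L^r(dx)` (`lintegral_rieszPotential_rpow_lt_top`).

For nonexistence, a nonzero `ω` has `I_β ω(x) ≥ c (|x| + R)^(β-n)`, whose `r`-th power is not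
integrable at infinity when `r (n-β) ≤ n`. -/

theorem lintegral_Ioc_rpow {a T : ℝ} (ha : 0 < a) (hT : 0 ≤ T) :
    ∫⁻ t in Set.Ioc 0 T, ENNReal.ofReal (a * t ^ (a - 1)) = ENNReal.ofReal (T ^ a) := by
  have hint : IntervalIntegrable (fun t : ℝ => a * t ^ (a - 1)) volume 0 T :=
    (intervalIntegral.intervalIntegrable_rpow' (by linarith)).const_mul a
  rw [← ofReal_integral_eq_lintegral_ofReal, ← intervalIntegral.integral_of_le hT,
    intervalIntegral.integral_const_mul, integral_rpow (Or.inl (by linarith))]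
  · congr 1
    rw [sub_add_cancel, Real.zero_rpow ha.ne']
    field_simp
    ring
  · exact (intervalIntegrable_iff_integrableOn_Ioc_of_le hT).1 hint
  · filter_upwards [ae_restrict_mem measurableSet_Ioc] with t ht
    have := Real.rpow_nonneg ht.1.le (a - 1)
    positivity

theorem ENNReal.rpow_eq_lintegral_indicator {a : ℝ} (ha : 0 < a) (c : ℝ≥0∞) :
    c ^ a = ∫⁻ t in Set.Ioi (0 : ℝ), ENNReal.ofReal (a * t ^ (a - 1)) *
      {s : ℝ | ENNReal.ofReal s ≤ c}.indicator 1 t := by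
  have key : ∀ T : ℝ, 0 ≤ T → ∀ c : ℝ≥0∞, ENNReal.ofReal T ≤ c → ENNReal.ofReal (T ^ a) ≤
      ∫⁻ t in Set.Ioi (0 : ℝ), ENNReal.ofReal (a * t ^ (a - 1)) *
        {s : ℝ | ENNReal.ofReal s ≤ c}.indicator 1 t := by
    intro T hT c hc
    rw [← lintegral_Ioc_rpow ha hT]
    refine le_trans ?_ (lintegral_mono_set (Set.Ioc_subset_Ioi_self : Set.Ioc 0 T ⊆ Set.Ioi 0))
    refine setLIntegral_mono' measurableSet_Ioc fun t ht => ?_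
    have : t ∈ {s : ℝ | ENNReal.ofReal s ≤ c} := (ENNReal.ofReal_le_ofReal ht.2).trans hc
    simp [Set.indicator_of_mem this]
  refine le_antisymm ?_ ?_
  · by_cases hc : c = ∞
    · subst hc
      rw [ENNReal.top_rpow_of_pos ha]
      refine le_of_forall_lt fun b hb => ?_
      lift b to NNReal using hb.ne
      -- The cutoff is chosen with `a`-th power `b + 1`, so the integral exceeds every finite `b`.
      have h := key ((b + 1 : ℝ) ^ a⁻¹) (by positivity) ∞ le_top
      refine lt_of_lt_of_le ?_ h
      rw [← Real.rpow_mul (by positivity), inv_mul_cancel₀ ha.ne', Real.rpow_one,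
        ENNReal.coe_nnreal_eq, ENNReal.ofReal_lt_ofReal_iff (by positivity)]
      linarith
    · have h := key c.toReal ENNReal.toReal_nonneg c (by rw [ENNReal.ofReal_toReal hc])
      rwa [← ENNReal.ofReal_rpow_of_nonneg ENNReal.toReal_nonneg ha.le,
        ENNReal.ofReal_toReal hc] at h
  · by_cases hc : c = ∞
    · subst hc
      simp [ENNReal.top_rpow_of_pos ha]
    · conv_rhs => rw [← ENNReal.ofReal_toReal hc,
        ENNReal.ofReal_rpow_of_nonneg ENNReal.toReal_nonneg ha.le,
        ← lintegral_Ioc_rpow ha ENNReal.toReal_nonneg]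
      rw [← lintegral_indicator measurableSet_Ioi, ← lintegral_indicator measurableSet_Ioc]
      refine lintegral_mono fun t => ?_
      by_cases h0 : t ∈ Set.Ioi (0 : ℝ)
      · rw [Set.indicator_of_mem h0]
        by_cases h1 : ENNReal.ofReal t ≤ c
        · rw [Set.indicator_of_mem (show t ∈ Set.Ioc 0 c.toReal from
            ⟨h0, (ENNReal.ofReal_le_iff_le_toReal hc).1 h1⟩)]
          refine (mul_le_mul_right (Set.indicator_le_self' (fun _ _ => zero_le) t) _).trans ?_
          simp
        · rw [Set.indicator_of_notMem (show t ∉ {s : ℝ | ENNReal.ofReal s ≤ c} from h1)]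
          simp
      · rw [Set.indicator_of_notMem h0]
        exact zero_le

/-- The layer cake formula for functions with values in `[0, ∞]`. -/
theorem lintegral_rpow_eq_lintegral_meas_ofReal_le {μ : Measure X} [SFinite μ] {f : X → ℝ≥0∞}
    (hf : Measurable f) {a : ℝ} (ha : 0 < a) :
    ∫⁻ x, f x ^ a ∂μ = ∫⁻ t in Set.Ioi (0 : ℝ),
      ENNReal.ofReal (a * t ^ (a - 1)) * μ {x | ENNReal.ofReal t ≤ f x} := by
  have hset : MeasurableSet {z : X × ℝ | ENNReal.ofReal z.2 ≤ f z.1} :=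
    measurableSet_le (by fun_prop) (by fun_prop)
  simp_rw [ENNReal.rpow_eq_lintegral_indicator ha]
  rw [lintegral_lintegral_swap]
  · refine lintegral_congr fun t => ?_
    have hm : MeasurableSet {x | ENNReal.ofReal t ≤ f x} := measurableSet_le (by fun_prop) hf
    rw [← lintegral_indicator_one hm, ← lintegral_const_mul _ (measurable_one.indicator hm)]
    rfl
  · refine Measurable.aemeasurable ?_
    refine Measurable.mul (by fun_prop) ?_
    exact (measurable_one.indicator hset : Measurable
      ({z : X × ℝ | ENNReal.ofReal z.2 ≤ f z.1}.indicator (1 : X × ℝ → ℝ≥0∞)))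

end General

/-! ### Pointwise properties of Riesz potentials. -/

section Potential

variable {n : ℕ} {β : ℝ} {μ ν : Measure (EuclideanSpace ℝ (Fin n))}

theorem measurable_edist_rpow (β : ℝ) (x : EuclideanSpace ℝ (Fin n)) :
    Measurable fun y => edist x y ^ (β - n) := by fun_prop

theorem measurable_rieszPotential (β : ℝ) (μ : Measure (EuclideanSpace ℝ (Fin n))) [SFinite μ] :
    Measurable (rieszPotential β μ) := by
  unfold rieszPotential
  exact Measurable.lintegral_prod_right' (ν := μ)
    (f := fun z : EuclideanSpace ℝ (Fin n) × EuclideanSpace ℝ (Fin n) =>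
      edist z.1 z.2 ^ (β - n)) (by fun_prop)

theorem rieszPotential_mono (h : μ ≤ ν) (x : EuclideanSpace ℝ (Fin n)) :
    rieszPotential β μ x ≤ rieszPotential β ν x := lintegral_mono' h le_rfl

theorem rieszPotential_withDensity {g : EuclideanSpace ℝ (Fin n) → ℝ≥0∞} (hg : Measurable g)
    (x : EuclideanSpace ℝ (Fin n)) :
    rieszPotential β (μ.withDensity g) x = ∫⁻ y, g y * edist x y ^ (β - n) ∂μ := by
  unfold rieszPotential
  rw [lintegral_withDensity_eq_lintegral_mul _ hg (measurable_edist_rpow β x)]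
  rfl

theorem rieszPotential_restrict_add_compl {s : Set (EuclideanSpace ℝ (Fin n))}
    (hs : MeasurableSet s) (x : EuclideanSpace ℝ (Fin n)) :
    rieszPotential β (μ.restrict s) x + rieszPotential β (μ.restrict sᶜ) x =
      rieszPotential β μ x := lintegral_add_compl _ hs

theorem lintegral_rieszPotential_comm [SFinite μ] [SFinite ν] :
    ∫⁻ x, rieszPotential β μ x ∂ν = ∫⁻ y, rieszPotential β ν y ∂μ := by
  unfold rieszPotential
  rw [lintegral_lintegral_swap (by fun_prop)]
  simp_rw [edist_comm]

/-- Lower semicontinuity, by Fatou: the kernel is continuous into `[0, ∞]` even on the diagonal. The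
maximum principle needs closedness to have nearest points. -/
theorem isClosed_rieszPotential_le (t : ℝ≥0∞) :
    IsClosed {x | rieszPotential β μ x ≤ t} := by
  refine isSeqClosed_iff_isClosed.1 fun a x ha hx => ?_
  have hlim : ∀ y, Tendsto (fun k => edist (a k) y ^ (β - n)) atTop (nhds (edist x y ^ (β - n))) :=
    fun y => (ENNReal.continuous_rpow_const.tendsto _).comp
      (hx.edist tendsto_const_nhds)
  calc rieszPotential β μ x = ∫⁻ y, liminf (fun k => edist (a k) y ^ (β - n)) atTop ∂μ :=
        lintegral_congr fun y => (hlim y).liminf_eq.symm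
    _ ≤ liminf (fun k => rieszPotential β μ (a k)) atTop :=
        lintegral_liminf_le fun k => measurable_edist_rpow β (a k)
    _ ≤ liminf (fun _ : ℕ => t) atTop := liminf_le_liminf (Eventually.of_forall ha)
    _ = t := liminf_const t

theorem ENNReal.rpow_le_rpow_of_neg {a b : ℝ≥0∞} {z : ℝ} (hz : z ≤ 0) (h : a ≤ b) :
    b ^ z ≤ a ^ z := by
  rw [← neg_neg z, ENNReal.rpow_neg, ENNReal.rpow_neg a]
  exact ENNReal.inv_le_inv.2 (ENNReal.rpow_le_rpow h (by linarith))

/-- The weak maximum principle for Riesz potentials. -/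
theorem rieszPotential_restrict_le (hβ : β < n) (t : ℝ≥0∞) (x : EuclideanSpace ℝ (Fin n)) :
    rieszPotential β (μ.restrict {y | rieszPotential β μ y ≤ t}) x ≤ 2 ^ (n - β) * t := by
  set F := {y | rieszPotential β μ y ≤ t} with hF
  have hFc : IsClosed F := isClosed_rieszPotential_le t
  rcases F.eq_empty_or_nonempty with h0 | hne
  · simp [h0, rieszPotential]
  -- With `z` a point of `F` nearest to `x`, every `y ∈ F` has `|z - y| ≤ 2 |x - y|`, so moving the
  -- pole from `x` to `z` costs only the factor `2^(n-β)`.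
  obtain ⟨z, hzF, hz⟩ := hFc.exists_infDist_eq_dist hne x
  have hle : ∀ y ∈ F, edist x y ^ (β - n) ≤ 2 ^ (n - β) * edist z y ^ (β - n) := by
    intro y hy
    have h1 : dist z y ≤ 2 * dist x y := by
      have := Metric.infDist_le_dist_of_mem (x := x) hy
      have := dist_triangle_left z y x
      linarith
    have h2 : edist z y ≤ 2 * edist x y := by
      have := ENNReal.ofReal_le_ofReal h1
      rwa [ENNReal.ofReal_mul (by norm_num), ENNReal.ofReal_ofNat, ← edist_dist,
        ← edist_dist] at this
    have h3 := ENNReal.rpow_le_rpow_of_neg (z := β - n) (by linarith) h2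
    rw [ENNReal.mul_rpow_of_ne_top (by norm_num) (edist_ne_top _ _)] at h3
    calc edist x y ^ (β - n) = 2 ^ (n - β) * (2 ^ (β - n) * edist x y ^ (β - n)) := by
          rw [← mul_assoc, ← ENNReal.rpow_add _ _ (by norm_num) (by norm_num)]
          simp
      _ ≤ _ := by gcongr
  calc rieszPotential β (μ.restrict F) x
      ≤ ∫⁻ y in F, 2 ^ (n - β) * edist z y ^ (β - n) ∂μ :=
        setLIntegral_mono' hFc.measurableSet hle
    _ = 2 ^ (n - β) * rieszPotential β (μ.restrict F) z :=
        lintegral_const_mul _ (measurable_edist_rpow β z)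
    _ ≤ 2 ^ (n - β) * rieszPotential β μ z := by
        gcongr; exact rieszPotential_mono Measure.restrict_le_self z
    _ ≤ 2 ^ (n - β) * t := by gcongr; exact hzF

/-- By the maximum principle the mass on `{I_β μ ≤ t}` contributes at most `2^(n-β) t`, hence at
most half of the potential at `x`; the other half comes from the complement. -/
theorem le_rieszPotential_restrict_lt (hβ : β < n) {t : ℝ≥0∞} (ht : t ≠ ∞)
    {x : EuclideanSpace ℝ (Fin n)} (hx : 2 * (2 ^ (n - β) * t) ≤ rieszPotential β μ x) :
    rieszPotential β μ x ≤
      2 * rieszPotential β (μ.restrict {y | t < rieszPotential β μ y}) x := by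
  have hF := (isClosed_rieszPotential_le (β := β) (μ := μ) t).measurableSet
  have h1 := rieszPotential_restrict_add_compl (β := β) (μ := μ) hF x
  have h2 := rieszPotential_restrict_le (μ := μ) hβ t x
  have h3 : {y | rieszPotential β μ y ≤ t}ᶜ = {y | t < rieszPotential β μ y} := by
    ext y; simp
  rw [h3] at h1
  set A := rieszPotential β (μ.restrict {y | rieszPotential β μ y ≤ t}) x
  set B := rieszPotential β (μ.restrict {y | t < rieszPotential β μ y}) x
  have hfin : (2 : ℝ≥0∞) ^ (n - β) * t ≠ ∞ :=
    ENNReal.mul_ne_top (ENNReal.rpow_ne_top_of_nonneg (by linarith) (by norm_num)) ht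
  have hA : A ≠ ∞ := ne_top_of_le_ne_top hfin h2
  have hAB : A ≤ B := by
    refine (ENNReal.add_le_add_iff_left hA).1 ?_
    rw [h1, ← two_mul]
    exact (by gcongr : 2 * A ≤ _).trans hx
  rw [← h1, two_mul]
  gcongr

/-- The lower bound `(I_β σ)^(1+a) ≤ C I_β((I_β σ)^a dσ)`. -/
theorem rieszPotential_rpow_le (hβ : β < n) [SFinite μ] {a : ℝ} (ha : 0 < a)
    (x : EuclideanSpace ℝ (Fin n)) :
    rieszPotential β μ x ^ (1 + a) ≤ 2 * (2 * 2 ^ (n - β)) ^ a *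
      rieszPotential β (μ.withDensity fun y => rieszPotential β μ y ^ a) x := by
  set h : ℝ≥0∞ := 2 * 2 ^ (n - β) with hh
  have hh0 : h ≠ 0 := by simp [hh]
  have hht : h ≠ ∞ :=
    ENNReal.mul_ne_top (by norm_num) (ENNReal.rpow_ne_top_of_nonneg (by linarith) (by norm_num))
  have hm : Measurable fun y => rieszPotential β μ y ^ a :=
    (measurable_rieszPotential β μ).pow_const a
  -- Half of the potential at `x` comes from the set where the density `(I_β μ)^a` exceeds `t^a`.
  -- The best admissible level is `t = I_β μ(x) / h`; if the potential is infinite, `t = 1`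
  -- suffices.
  have key : ∀ t : ℝ≥0∞, t ≠ ∞ → h * t ≤ rieszPotential β μ x → t ^ a * rieszPotential β μ x ≤
      2 * rieszPotential β (μ.withDensity fun y => rieszPotential β μ y ^ a) x := by
    intro t ht hx
    have h1 := le_rieszPotential_restrict_lt hβ ht (by rwa [← mul_assoc])
    have hms : MeasurableSet {y | t < rieszPotential β μ y} :=
      measurableSet_lt measurable_const (measurable_rieszPotential β μ)
    have h2 : t ^ a * rieszPotential β (μ.restrict {y | t < rieszPotential β μ y}) x ≤
        rieszPotential β (μ.withDensity fun y => rieszPotential β μ y ^ a) x := by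
      rw [rieszPotential_withDensity hm, rieszPotential,
        ← lintegral_const_mul _ (measurable_edist_rpow β x)]
      refine (setLIntegral_mono' hms fun y hy => ?_).trans (setLIntegral_le_lintegral _ _)
      have hy' : t < rieszPotential β μ y := hy
      gcongr
    calc t ^ a * rieszPotential β μ x ≤ t ^ a * (2 * _) := mul_le_mul_right h1 _
      _ = 2 * (t ^ a * _) := by ring
      _ ≤ _ := mul_le_mul_right h2 _
  by_cases hx0 : rieszPotential β μ x = 0
  · rw [hx0, ENNReal.zero_rpow_of_pos (by linarith)]; exact zero_le
  by_cases hxt : rieszPotential β μ x = ∞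
  · have := key 1 (by norm_num) (by rw [hxt]; exact le_top)
    rw [hxt, ENNReal.one_rpow, one_mul, top_le_iff] at this
    rw [mul_comm 2, mul_assoc, this, ENNReal.mul_top]
    · exact le_top
    · simp [ENNReal.rpow_eq_zero_iff, hh0, hht]
  · have := key (h⁻¹ * rieszPotential β μ x) (ENNReal.mul_ne_top (by simp [hh0]) hxt)
      (by rw [← mul_assoc, ENNReal.mul_inv_cancel hh0 hht, one_mul])
    rw [ENNReal.mul_rpow_of_nonneg _ _ ha.le, ENNReal.inv_rpow] at this
    have e0 : h ^ a ≠ 0 := by simp [ENNReal.rpow_eq_zero_iff, hh0, hht]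
    have e1 : h ^ a ≠ ∞ := ENNReal.rpow_ne_top_of_nonneg ha.le hht
    rw [ENNReal.rpow_add _ _ hx0 hxt, ENNReal.rpow_one]
    calc rieszPotential β μ x * rieszPotential β μ x ^ a
        = h ^ a * ((h ^ a)⁻¹ * rieszPotential β μ x ^ a * rieszPotential β μ x) := by
          rw [mul_assoc, ← mul_assoc (h ^ a), ENNReal.mul_inv_cancel e0 e1, one_mul, mul_comm]
      _ ≤ h ^ a * _ := mul_le_mul_right this _
      _ = _ := by ring

theorem ofReal_le_edist_rpow_iff (hβ : β < n) {t : ℝ} (ht : 0 < t)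
    (x y : EuclideanSpace ℝ (Fin n)) :
    ENNReal.ofReal t ≤ edist x y ^ (β - n) ↔ y ∈ Metric.closedBall x ((t⁻¹) ^ (n - β)⁻¹) := by
  have h0 : (0 : ℝ) < n - β := by linarith
  rw [show β - n = -(n - β) by ring, ENNReal.rpow_neg, ENNReal.le_inv_iff_le_inv,
    ← ENNReal.le_rpow_inv_iff h0, ← ENNReal.ofReal_inv_of_pos ht,
    ENNReal.ofReal_rpow_of_pos (by positivity), edist_dist,
    ENNReal.ofReal_le_ofReal_iff (by positivity), Metric.mem_closedBall, dist_comm]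

/-- The Riesz potential in terms of the measures of balls. -/
theorem rieszPotential_eq_lintegral_closedBall (hβ : β < n) [SFinite μ]
    (x : EuclideanSpace ℝ (Fin n)) :
    rieszPotential β μ x =
      ∫⁻ t in Set.Ioi (0 : ℝ), μ (Metric.closedBall x ((t⁻¹) ^ (n - β)⁻¹)) := by
  have h := lintegral_rpow_eq_lintegral_meas_ofReal_le (μ := μ) (measurable_edist_rpow β x)
    one_pos
  simp only [ENNReal.rpow_one, sub_self, Real.rpow_zero, mul_one, ENNReal.ofReal_one,
    one_mul] at h
  rw [rieszPotential, h]
  refine setLIntegral_congr_fun measurableSet_Ioi fun t ht => ?_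
  congr 1
  ext y
  exact ofReal_le_edist_rpow_iff hβ ht x y

end Potential

/-! ### Weak type estimate, and integrability from finite energy. -/

section WeakType

variable {n : ℕ} {β : ℝ}

theorem volume_closedBall_inv_rpow (hβ : β < n) {t : ℝ} (ht : 0 < t)
    (x : EuclideanSpace ℝ (Fin n)) :
    volume (Metric.closedBall x ((t⁻¹) ^ (n - β)⁻¹)) =
      ENNReal.ofReal (t ^ (-(n / (n - β)))) *
        volume (Metric.ball (0 : EuclideanSpace ℝ (Fin n)) 1) := by
  have h0 : (0 : ℝ) < n - β := by linarith
  rw [Measure.addHaar_closedBall _ _ (by positivity), finrank_euclideanSpace_fin]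
  congr 2
  rw [← Real.rpow_natCast, ← Real.rpow_mul (by positivity), Real.inv_rpow ht.le,
    ← Real.rpow_neg ht.le]
  congr 1
  field_simp

/-- The Riesz potential of a set of finite volume is bounded in terms of the volume. -/
theorem exists_rieszPotential_volume_restrict_le (hβ0 : 0 < β) (hβ : β < n) :
    ∃ C : ℝ≥0∞, C ≠ ∞ ∧ ∀ (x : EuclideanSpace ℝ (Fin n)) (E : Set (EuclideanSpace ℝ (Fin n))),
      volume E ≠ ∞ → rieszPotential β (volume.restrict E) x ≤ C * volume E ^ (β / n) := by
  have h0 : (0 : ℝ) < n - β := by linarith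
  have hn : (0 : ℝ) < n := by linarith
  set p : ℝ := n / (n - β) with hp
  have hp1 : 1 < p := by rw [hp, one_lt_div h0]; linarith
  set c := volume (Metric.ball (0 : EuclideanSpace ℝ (Fin n)) 1) with hc
  have hcfin : c ≠ ∞ := measure_ball_lt_top.ne
  refine ⟨1 + ENNReal.ofReal (p - 1)⁻¹ * c, ?_, fun x E hE => ?_⟩
  · exact ENNReal.add_ne_top.2 ⟨by simp, ENNReal.mul_ne_top ENNReal.ofReal_ne_top hcfin⟩
  by_cases hE0 : volume E = 0
  · simp [Measure.restrict_eq_zero.2 hE0, rieszPotential]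
  set M := (volume E).toReal with hM
  have hMpos : 0 < M := ENNReal.toReal_pos hE0 hE
  have hME : volume E = ENNReal.ofReal M := (ENNReal.ofReal_toReal hE).symm
  -- The level at which the two bounds for the measure of the ball, `M` and `c t^(-p)`, balance up
  -- to `c`; both pieces are then of order `M^(β/n)`.
  set T : ℝ := M ^ (-p⁻¹) with hT
  have hTpos : 0 < T := by positivity
  have hexp : 1 - p⁻¹ = β / n := by rw [hp]; field_simp; ring
  rw [rieszPotential_eq_lintegral_closedBall hβ, ← Set.Ioc_union_Ioi_eq_Ioi hTpos.le,
    add_mul, one_mul]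
  refine (lintegral_union_le _ _ _).trans (add_le_add ?_ ?_)
  · calc ∫⁻ t in Set.Ioc 0 T, (volume.restrict E) (Metric.closedBall x ((t⁻¹) ^ (n - β)⁻¹))
        ≤ ∫⁻ _ in Set.Ioc 0 T, volume E := by
          refine lintegral_mono fun t => ?_
          exact (measure_mono (Set.subset_univ _)).trans (by simp)
      _ = ENNReal.ofReal (M * T) := by
          rw [setLIntegral_const, Real.volume_Ioc, sub_zero, hME, ENNReal.ofReal_mul hMpos.le]
      _ = volume E ^ (β / n) := by
          rw [hME, ENNReal.ofReal_rpow_of_pos hMpos, ← hexp, hT, sub_eq_add_neg,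
            Real.rpow_add hMpos, Real.rpow_one]
  · have hint : IntegrableOn (fun t : ℝ => t ^ (-p)) (Set.Ioi T) :=
      integrableOn_Ioi_rpow_of_lt (by linarith) hTpos
    calc ∫⁻ t in Set.Ioi T, (volume.restrict E) (Metric.closedBall x ((t⁻¹) ^ (n - β)⁻¹))
        ≤ ∫⁻ t in Set.Ioi T, ENNReal.ofReal (t ^ (-p)) * c := by
          refine setLIntegral_mono' measurableSet_Ioi fun t ht => ?_
          rw [hp, hc, ← volume_closedBall_inv_rpow hβ (hTpos.trans ht) x]
          exact Measure.restrict_apply_le _ _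
      _ = ENNReal.ofReal (T ^ (1 - p) / (p - 1)) * c := by
          rw [lintegral_mul_const _ (by fun_prop), ← ofReal_integral_eq_lintegral_ofReal hint,
            integral_Ioi_rpow_of_lt (by linarith) hTpos]
          · congr 2
            rw [show -p + 1 = -(p - 1) by ring, show 1 - p = -(p - 1) by ring, neg_div_neg_eq]
          · filter_upwards [ae_restrict_mem measurableSet_Ioi] with t ht
            exact Real.rpow_nonneg (hTpos.trans ht).le _
      _ = ENNReal.ofReal (p - 1)⁻¹ * c * volume E ^ (β / n) := by
          have : T ^ (1 - p) = M ^ (β / n) := by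
            rw [hT, ← Real.rpow_mul hMpos.le, ← hexp]
            congr 1
            field_simp
            ring
          rw [this, hME, ENNReal.ofReal_rpow_of_pos hMpos, div_eq_inv_mul,
            ENNReal.ofReal_mul (inv_nonneg.2 (by linarith))]
          ring

/-- The Riesz potential is of weak type `(1, n / (n - β))`. -/
theorem exists_volume_le_rieszPotential_le (hβ0 : 0 < β) (hβ : β < n) :
    ∃ C : ℝ≥0∞, C ≠ ∞ ∧ ∀ (ν : Measure (EuclideanSpace ℝ (Fin n))) [SFinite ν] (t : ℝ≥0∞),
      t ≠ 0 → t ≠ ∞ →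
      volume {x | t ≤ rieszPotential β ν x} ≤ (C * ν Set.univ / t) ^ (n / (n - β)) := by
  have h0 : (0 : ℝ) < n - β := by linarith
  have hn : (0 : ℝ) < n := by linarith
  obtain ⟨C, hC, hCle⟩ := exists_rieszPotential_volume_restrict_le (n := n) hβ0 hβ
  refine ⟨C, hC, fun ν _ t ht0 htt => ?_⟩
  set S := {x | t ≤ rieszPotential β ν x} with hS
  -- Cutting to a ball makes the volume finite, so that a power of it can be cancelled after
  -- dualising: `t |E| ≤ ∫_E I_β ν = ∫ I_β(1_E) dν`.
  have key : ∀ k : ℕ, volume (S ∩ Metric.closedBall 0 k) ≤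
      (C * ν Set.univ / t) ^ (n / (n - β)) := by
    intro k
    set E := S ∩ Metric.closedBall 0 k
    have hEfin : volume E ≠ ∞ :=
      ne_top_of_le_ne_top (measure_closedBall_lt_top (x := 0) (r := k)).ne
        (measure_mono Set.inter_subset_right)
    by_cases hE0 : volume E = 0
    · rw [hE0]; exact zero_le
    have h1 : t * volume E ≤ C * volume E ^ (β / n) * ν Set.univ := by
      calc t * volume E = ∫⁻ _ in E, t := by rw [setLIntegral_const]
        _ ≤ ∫⁻ x in E, rieszPotential β ν x :=
          setLIntegral_mono (measurable_rieszPotential β ν) fun x hx => hx.1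
        _ = ∫⁻ y, rieszPotential β (volume.restrict E) y ∂ν := lintegral_rieszPotential_comm
        _ ≤ ∫⁻ _, C * volume E ^ (β / n) ∂ν := lintegral_mono fun y => hCle y E hEfin
        _ = _ := by rw [lintegral_const]
    have h2 : volume E = volume E ^ (β / n) * volume E ^ ((n - β) / n) := by
      rw [← ENNReal.rpow_add _ _ hE0 hEfin, ← add_div, add_sub_cancel, div_self hn.ne',
        ENNReal.rpow_one]
    have e0 : volume E ^ (β / n) ≠ 0 := by simp [ENNReal.rpow_eq_zero_iff, hE0, hEfin]
    have e1 : volume E ^ (β / n) ≠ ∞ := ENNReal.rpow_ne_top_of_nonneg (by positivity) hEfin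
    have h3 : volume E ^ ((n - β) / n) ≤ C * ν Set.univ / t := by
      rw [ENNReal.le_div_iff_mul_le (Or.inl ht0) (Or.inl htt)]
      refine (ENNReal.mul_le_mul_iff_right e0 e1).1 ?_
      calc _ = t * (volume E ^ (β / n) * volume E ^ ((n - β) / n)) := by ring
        _ = t * volume E := by rw [← h2]
        _ ≤ _ := h1
        _ = _ := by ring
    calc volume E = (volume E ^ ((n - β) / n)) ^ (n / (n - β)) := by
          rw [← ENNReal.rpow_mul, div_mul_div_cancel₀ hn.ne', div_self h0.ne', ENNReal.rpow_one]
      _ ≤ _ := ENNReal.rpow_le_rpow h3 (by positivity)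
  have hU : S = ⋃ k : ℕ, S ∩ Metric.closedBall 0 k := by
    rw [← Set.inter_iUnion, Metric.iUnion_closedBall_nat, Set.inter_univ]
  have hmono : Monotone fun k : ℕ => S ∩ Metric.closedBall (0 : EuclideanSpace ℝ (Fin n)) k :=
    fun i j hij => Set.inter_subset_inter_right _
      (Metric.closedBall_subset_closedBall (by exact_mod_cast hij))
  rw [hU, hmono.measure_iUnion]
  exact iSup_le key

/-- A potential of finite generalized energy `∫ (I_β μ)^γ dμ` is in `L^r` for
`r = (1 + γ) n / (n - β)`. -/
theorem lintegral_rieszPotential_rpow_lt_top (hβ0 : 0 < β) (hβ : β < n) {γ r : ℝ} (hγ : 0 < γ)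
    (hr : r = (1 + γ) * (n / (n - β))) {μ : Measure (EuclideanSpace ℝ (Fin n))} [SFinite μ]
    (hE : ∫⁻ x, rieszPotential β μ x ^ γ ∂μ ≠ ∞) :
    ∫⁻ x, rieszPotential β μ x ^ r < ∞ := by
  have h0 : (0 : ℝ) < n - β := by linarith
  set p : ℝ := n / (n - β) with hp
  have hp1 : 1 < p := by rw [hp, one_lt_div h0]; linarith
  have hr0 : 0 < r := by rw [hr]; positivity
  obtain ⟨C, hC, hweak⟩ := exists_volume_le_rieszPotential_le (n := n) hβ0 hβ
  set u := rieszPotential β μ with hu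
  have hum : Measurable u := measurable_rieszPotential β μ
  set E := ∫⁻ x, u x ^ γ ∂μ with hEdef
  set h : ℝ≥0∞ := 2 ^ (n - β) with hh
  have hh0 : h ≠ 0 := by simp [hh]
  have hht : h ≠ ∞ := ENNReal.rpow_ne_top_of_nonneg h0.le (by norm_num)
  set m : ℝ → ℝ≥0∞ := fun t => μ {x | ENNReal.ofReal t ≤ u x} with hm
  have hlevel : ∀ t : ℝ, 0 < t → volume {x | ENNReal.ofReal t ≤ u x / (2 * h)} ≤
      (C / h) ^ p * (m t / ENNReal.ofReal t) ^ p := by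
    intro t ht
    have hT0 : ENNReal.ofReal t ≠ 0 := by simpa using ht
    have hTt : ENNReal.ofReal t ≠ ∞ := ENNReal.ofReal_ne_top
    set T := ENNReal.ofReal t
    have h1 : {x | T ≤ u x / (2 * h)} ⊆
        {x | h * T ≤ rieszPotential β (μ.restrict {y | T < u y}) x} := by
      intro x hx
      have hx1 : T ≤ u x / (2 * h) := hx
      rw [ENNReal.le_div_iff_mul_le (Or.inl (by simp [hh0]))
        (Or.inl (ENNReal.mul_ne_top (by norm_num) hht))] at hx1
      have hx2 : 2 * (h * T) ≤ u x := by rwa [← mul_assoc, mul_comm]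
      have := hx2.trans (le_rieszPotential_restrict_lt hβ hTt hx2)
      exact (ENNReal.mul_le_mul_iff_right (by norm_num) (by norm_num)).1 this
    refine (measure_mono h1).trans ((hweak _ (h * T) (mul_ne_zero hh0 hT0)
      (ENNReal.mul_ne_top hht hTt)).trans ?_)
    rw [← ENNReal.mul_rpow_of_nonneg _ _ (by positivity)]
    refine ENNReal.rpow_le_rpow ?_ (by positivity)
    rw [Measure.restrict_apply_univ, div_eq_mul_inv, ENNReal.mul_inv (Or.inl hh0) (Or.inl hht)]
    calc C * μ {y | T < u y} * (h⁻¹ * T⁻¹) = C / h * (μ {y | T < u y} / T) := by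
          rw [div_eq_mul_inv, div_eq_mul_inv]; ring
      _ ≤ _ := by
          gcongr
          exact measure_mono fun y (hy : T < u y) => hy.le
  have hmarkov : ∀ t : ℝ, 0 < t → ENNReal.ofReal t ^ γ * m t ≤ E := by
    intro t ht
    refine le_trans ?_ (mul_meas_ge_le_lintegral (hum.pow_const γ) (ENNReal.ofReal t ^ γ))
    refine mul_le_mul_right (measure_mono fun y hy => ?_) _
    exact ENNReal.rpow_le_rpow hy hγ.le
  -- Of the `p` powers of `m t`, Markov bounds `p - 1` by the energy; the last one is kept, and
  -- integrates to the energy again. The powers of `t` match because `r = (1 + γ) p`.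
  have hpt : ∀ t : ℝ, 0 < t → ENNReal.ofReal (r * t ^ (r - 1)) *
      volume {x | ENNReal.ofReal t ≤ u x / (2 * h)} ≤
      (C / h) ^ p * E ^ (p - 1) * ENNReal.ofReal (r / γ) *
        (ENNReal.ofReal (γ * t ^ (γ - 1)) * m t) := by
    intro t ht
    have hT0 : ENNReal.ofReal t ≠ 0 := by simpa using ht
    have hTt : ENNReal.ofReal t ≠ ∞ := ENNReal.ofReal_ne_top
    have e1 : ENNReal.ofReal (r * t ^ (r - 1)) = ENNReal.ofReal r * ENNReal.ofReal t ^ (r - 1) := by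
      rw [ENNReal.ofReal_mul hr0.le, ENNReal.ofReal_rpow_of_pos ht]
    have e2 : ENNReal.ofReal (r / γ) * ENNReal.ofReal (γ * t ^ (γ - 1)) =
        ENNReal.ofReal r * ENNReal.ofReal t ^ (γ - 1) := by
      rw [← ENNReal.ofReal_mul (by positivity), ENNReal.ofReal_rpow_of_pos ht,
        ← ENNReal.ofReal_mul hr0.le]
      congr 1
      field_simp
    have e3 : ENNReal.ofReal t ^ (r - 1) * (m t / ENNReal.ofReal t) ^ p =
        (ENNReal.ofReal t ^ γ * m t) ^ (p - 1) * (ENNReal.ofReal t ^ (γ - 1) * m t) := by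
      set T := ENNReal.ofReal t
      have hmt : m t ^ p = m t ^ (p - 1) * m t := by
        conv_lhs => rw [← sub_add_cancel p 1,
          ENNReal.rpow_add_of_nonneg _ _ (by linarith) zero_le_one, ENNReal.rpow_one]
      rw [ENNReal.div_rpow_of_nonneg _ _ (by linarith), div_eq_mul_inv, ← ENNReal.rpow_neg,
        ENNReal.mul_rpow_of_nonneg _ _ (by linarith), ← ENNReal.rpow_mul, hmt]
      calc _ = (T ^ (r - 1) * T ^ (-p)) * (m t ^ (p - 1) * m t) := by ring
        _ = (T ^ (γ * (p - 1)) * T ^ (γ - 1)) * (m t ^ (p - 1) * m t) := by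
          rw [← ENNReal.rpow_add _ _ hT0 hTt, ← ENNReal.rpow_add _ _ hT0 hTt]
          congr 2
          rw [hr]; ring
        _ = _ := by ring
    calc _ ≤ ENNReal.ofReal r * ENNReal.ofReal t ^ (r - 1) *
          ((C / h) ^ p * (m t / ENNReal.ofReal t) ^ p) := by
            rw [e1]; exact mul_le_mul_right (hlevel t ht) _
      _ = ENNReal.ofReal r * (C / h) ^ p *
          (ENNReal.ofReal t ^ (r - 1) * (m t / ENNReal.ofReal t) ^ p) := by ring
      _ = ENNReal.ofReal r * (C / h) ^ p * ((ENNReal.ofReal t ^ γ * m t) ^ (p - 1) *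
          (ENNReal.ofReal t ^ (γ - 1) * m t)) := by rw [e3]
      _ ≤ ENNReal.ofReal r * (C / h) ^ p * (E ^ (p - 1) *
          (ENNReal.ofReal t ^ (γ - 1) * m t)) := by
            gcongr
            exact hmarkov t ht
      _ = (C / h) ^ p * E ^ (p - 1) * (ENNReal.ofReal r * ENNReal.ofReal t ^ (γ - 1)) * m t := by
            ring
      _ = _ := by rw [← e2]; ring
  have hscaled : ∫⁻ x, (u x / (2 * h)) ^ r < ∞ := by
    rw [lintegral_rpow_eq_lintegral_meas_ofReal_le (by fun_prop) hr0]
    refine (setLIntegral_mono' measurableSet_Ioi hpt).trans_lt ?_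
    have hfin : (C / h) ^ p * E ^ (p - 1) * ENNReal.ofReal (r / γ) ≠ ∞ :=
      ENNReal.mul_ne_top (ENNReal.mul_ne_top
        (ENNReal.rpow_ne_top_of_nonneg (by linarith) (ENNReal.div_ne_top hC hh0))
        (ENNReal.rpow_ne_top_of_nonneg (by linarith) hE)) ENNReal.ofReal_ne_top
    rw [lintegral_const_mul' _ _ hfin, ← lintegral_rpow_eq_lintegral_meas_ofReal_le hum hγ]
    exact ENNReal.mul_lt_top hfin.lt_top hE.lt_top
  have h2h0 : 2 * h ≠ 0 := by simp [hh0]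
  have h2ht : 2 * h ≠ ∞ := ENNReal.mul_ne_top (by norm_num) hht
  calc ∫⁻ x, u x ^ r = ∫⁻ x, (2 * h) ^ r * (u x / (2 * h)) ^ r := by
        refine lintegral_congr fun x => ?_
        rw [← ENNReal.mul_rpow_of_nonneg _ _ hr0.le, ENNReal.mul_div_cancel h2h0 h2ht]
    _ = (2 * h) ^ r * ∫⁻ x, (u x / (2 * h)) ^ r := lintegral_const_mul _ (by fun_prop)
    _ < ∞ := ENNReal.mul_lt_top (ENNReal.rpow_lt_top_of_nonneg hr0.le h2ht) hscaled

end WeakType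

/-! ### Weak type bound for the centred maximal function. -/

section Maximal

/-- If every point of `E` is the centre of a ball whose `σ`-measure is controlled by its
`ω`-measure, then so is `σ E`. -/
theorem exists_mul_measure_le_of_closedBall (X : Type*) [MetricSpace X] [SecondCountableTopology X]
    [MeasurableSpace X] [OpensMeasurableSpace X] [HasBesicovitchCovering X] :
    ∃ N : ℕ, ∀ (σ ω : Measure X) (t : ℝ≥0∞) (E : Set X),
      (∀ x ∈ E, ∃ ρ > 0, t * σ (Metric.closedBall x ρ) ≤ ω (Metric.closedBall x ρ)) →
      t * σ E ≤ N * ω Set.univ := by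
  obtain ⟨N, τ, hτ, hN⟩ := HasBesicovitchCovering.no_satelliteConfig (α := X)
  refine ⟨N, fun σ ω t E hE => ?_⟩
  -- The Besicovitch theorem needs bounded radii; `F R` exhausts `E` as `R` grows. It gives `N`
  -- disjoint families, each of total `ω`-mass at most `ω univ`.
  set F : ℕ → Set X := fun R =>
    {x | x ∈ E ∧ ∃ ρ : ℝ, 0 < ρ ∧ ρ ≤ R ∧ t * σ (Metric.closedBall x ρ) ≤ ω (Metric.closedBall x ρ)}
    with hF
  have hU : E = ⋃ R, F R := by
    ext x
    simp only [hF, Set.mem_iUnion, Set.mem_ofPred_eq]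
    refine ⟨fun hx => ?_, fun ⟨_, hx, _⟩ => hx⟩
    obtain ⟨ρ, hρ, h⟩ := hE x hx
    exact ⟨⌈ρ⌉₊, hx, ρ, hρ, Nat.le_ceil ρ, h⟩
  have hmono : Monotone F := fun i j hij x ⟨hx, ρ, hρ, hle, h⟩ =>
    ⟨hx, ρ, hρ, hle.trans (by exact_mod_cast hij), h⟩
  rw [hU, hmono.measure_iUnion, ENNReal.mul_iSup]
  refine iSup_le fun R => ?_
  choose ρ hρ0 hρR hρ using fun x : F R => x.2.2
  obtain ⟨s, hdisj, hcov⟩ := Besicovitch.exist_disjoint_covering_families hτ hN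
    { c := fun x : F R => (x : X), r := ρ, rpos := hρ0, r_bound := R, r_le := hρR }
  have hcount : ∀ i, (s i).Countable := fun i =>
    (hdisj i).countable_of_nonempty_interior fun j _ =>
      ⟨j, Metric.ball_subset_interior_closedBall (Metric.mem_ball_self (hρ0 j))⟩
  calc t * σ (F R)
      ≤ t * σ (⋃ i, ⋃ j ∈ s i, Metric.closedBall (j : X) (ρ j)) := by
        gcongr
        intro x hx
        have := hcov ⟨⟨x, hx⟩, rfl⟩
        simp only [Set.mem_iUnion] at this ⊢
        obtain ⟨i, j, hj, h⟩ := this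
        exact ⟨i, j, hj, Metric.ball_subset_closedBall h⟩
    _ ≤ t * ∑ i, ∑' j : s i, σ (Metric.closedBall (j : X) (ρ j)) := by
        gcongr
        refine (measure_iUnion_fintype_le _ _).trans (Finset.sum_le_sum fun i _ => ?_)
        exact measure_biUnion_le σ (hcount i) _
    _ = ∑ i, ∑' j : s i, t * σ (Metric.closedBall (j : X) (ρ j)) := by
        rw [Finset.mul_sum]
        simp_rw [ENNReal.tsum_mul_left]
    _ ≤ ∑ _i : Fin N, ω Set.univ := by
        refine Finset.sum_le_sum fun i _ => ?_
        calc ∑' j : s i, t * σ (Metric.closedBall (j : X) (ρ j))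
            ≤ ∑' j : s i, ω (Metric.closedBall (j : X) (ρ j)) :=
              ENNReal.tsum_le_tsum fun j => hρ j
          _ = ω (⋃ j ∈ s i, Metric.closedBall (j : X) (ρ j)) :=
              (measure_biUnion (hcount i) (hdisj i) fun _ _ => measurableSet_closedBall).symm
          _ ≤ ω Set.univ := measure_mono (Set.subset_univ _)
    _ = N * ω Set.univ := by simp

end Maximal

/-! ### Weighted norm inequalities. -/

section NormInequality

variable {n : ℕ} {β : ℝ} {σ ω : Measure (EuclideanSpace ℝ (Fin n))}

/-- Both potentials integrate the measures of the same balls centred at `x`, so a bound for every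
ball would pass to the potentials. Thus `I_β ω / I_β σ` is at most the centred maximal function of
`ω` relative to `σ`. -/
theorem exists_closedBall_of_mul_rieszPotential_lt (hβ : β < n) [SFinite σ] [SFinite ω]
    {t : ℝ≥0∞} (ht : t ≠ ∞) {x : EuclideanSpace ℝ (Fin n)}
    (hx : t * rieszPotential β σ x < rieszPotential β ω x) :
    ∃ ρ > 0, t * σ (Metric.closedBall x ρ) ≤ ω (Metric.closedBall x ρ) := by
  by_contra! hcon
  refine hx.not_ge ?_
  rw [rieszPotential_eq_lintegral_closedBall hβ, rieszPotential_eq_lintegral_closedBall hβ,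
    ← lintegral_const_mul' _ _ ht]
  refine setLIntegral_mono' measurableSet_Ioi fun s (hs : 0 < s) => ?_
  exact (hcon _ (by positivity)).le

/-- The operator `g ↦ I_β(g dσ) / I_β σ` is bounded on `L^p(σ)` for `p > 1`. -/
theorem exists_lintegral_rieszPotential_div_rpow_le (n : ℕ) {p : ℝ} (hp : 1 < p) :
    ∃ C : ℝ≥0∞, C ≠ ∞ ∧ ∀ (β : ℝ), β < n → ∀ (σ : Measure (EuclideanSpace ℝ (Fin n))) [SFinite σ]
      (g : EuclideanSpace ℝ (Fin n) → ℝ≥0∞), Measurable g →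
      (∀ x, rieszPotential β σ x ≠ 0) → (∀ᵐ x ∂σ, rieszPotential β σ x ≠ ∞) →
      ∫⁻ x, (rieszPotential β (σ.withDensity g) x / rieszPotential β σ x) ^ p ∂σ ≤
        C * ∫⁻ x, g x ^ p ∂σ := by
  obtain ⟨N, hN⟩ := exists_mul_measure_le_of_closedBall (EuclideanSpace ℝ (Fin n))
  have hp0 : 0 < p - 1 := by linarith
  have hfin : 4 * (N : ℝ≥0∞) * ENNReal.ofReal (p / (p - 1)) ≠ ∞ :=
    ENNReal.mul_ne_top (ENNReal.mul_ne_top (by norm_num) (ENNReal.natCast_ne_top N))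
      ENNReal.ofReal_ne_top
  refine ⟨4 * N * ENNReal.ofReal (p / (p - 1)) * 2 ^ (p - 1), ENNReal.mul_ne_top hfin
    (ENNReal.rpow_ne_top_of_nonneg hp0.le (by norm_num)), fun β hβ σ _ g hg hK0 hKt => ?_⟩
  set K := rieszPotential β σ with hK
  set v := rieszPotential β (σ.withDensity g) with hv
  have hKm : Measurable K := measurable_rieszPotential β σ
  have hvm : Measurable v := measurable_rieszPotential β _
  -- Marcinkiewicz truncation: the part of `g` below `T / 2` contributes at most `T / 2 * K`, so the
  -- part on `A` contributes at least as much. The weak type bound is applied at `T / 4` to have a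
  -- strict inequality.
  have hlevel : ∀ t : ℝ, 0 < t → σ {x | ENNReal.ofReal t ≤ v x / K x} ≤
      4 * N * (ENNReal.ofReal t)⁻¹ * σ.withDensity g {x | ENNReal.ofReal t ≤ 2 * g x} := by
    intro t ht
    have hT0 : ENNReal.ofReal t ≠ 0 := by simpa using ht
    have hTt : ENNReal.ofReal t ≠ ∞ := ENNReal.ofReal_ne_top
    set T := ENNReal.ofReal t
    set A := {x | T ≤ 2 * g x} with hA
    have hAm : MeasurableSet A := measurableSet_le measurable_const (by fun_prop)
    have hT4 : T / 4 ≠ ∞ := ENNReal.div_ne_top hTt (by norm_num)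
    have hT4' : T / 4 ≠ 0 := by simp [ENNReal.div_eq_zero_iff, hT0]
    have hT24 : T / 4 + T / 4 = T / 2 := by
      rw [← two_mul, show (4 : ℝ≥0∞) = 2 * 2 by norm_num, div_eq_mul_inv, div_eq_mul_inv,
        ENNReal.mul_inv (by simp) (by simp)]
      calc 2 * (T * (2⁻¹ * 2⁻¹)) = (2 * 2⁻¹) * (T * 2⁻¹) := by ring
        _ = _ := by rw [ENNReal.mul_inv_cancel (by norm_num) (by norm_num), one_mul]
    have hrest : ∀ x, rieszPotential β ((σ.withDensity g).restrict Aᶜ) x ≤ T / 2 * K x := by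
      intro x
      rw [restrict_withDensity hAm.compl, rieszPotential_withDensity hg, hK, rieszPotential,
        ← lintegral_const_mul _ (measurable_edist_rpow β x)]
      refine (setLIntegral_mono' hAm.compl fun y hy => ?_).trans (setLIntegral_le_lintegral _ _)
      have hy' : 2 * g y < T := not_le.1 hy
      gcongr
      rw [ENNReal.le_div_iff_mul_le (by simp) (by simp), mul_comm]
      exact hy'.le
    have hsub : σ {x | T ≤ v x / K x} ≤
        σ {x | T / 4 * K x < rieszPotential β ((σ.withDensity g).restrict A) x} := by
      refine measure_mono_ae ?_
      filter_upwards [hKt] with x hxt hx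
      have hx1 : T ≤ v x / K x := hx
      rw [ENNReal.le_div_iff_mul_le (Or.inl (hK0 x)) (Or.inl hxt)] at hx1
      have hadd := rieszPotential_restrict_add_compl (β := β) (μ := σ.withDensity g) hAm x
      have h2 : T / 2 * K x ≠ ∞ :=
        ENNReal.mul_ne_top (ENNReal.div_ne_top hTt (by norm_num)) hxt
      have h3 : T / 2 * K x ≤ rieszPotential β ((σ.withDensity g).restrict A) x := by
        refine (ENNReal.add_le_add_iff_right h2).1 ?_
        calc T / 2 * K x + T / 2 * K x = T * K x := by rw [← add_mul, ENNReal.add_halves]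
          _ ≤ v x := hx1
          _ = _ := hadd.symm
          _ ≤ _ := by gcongr; exact hrest x
      refine lt_of_lt_of_le ?_ h3
      rw [← hT24, add_mul]
      exact ENNReal.lt_add_right (ENNReal.mul_ne_top hT4 hxt) (mul_ne_zero hT4' (hK0 x))
    have hweak := hN σ ((σ.withDensity g).restrict A) (T / 4)
      {x | T / 4 * K x < rieszPotential β ((σ.withDensity g).restrict A) x}
      fun x hx => exists_closedBall_of_mul_rieszPotential_lt hβ hT4 hx
    rw [Measure.restrict_apply_univ] at hweak
    refine hsub.trans ?_
    calc σ {x | T / 4 * K x < rieszPotential β ((σ.withDensity g).restrict A) x}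
        = (T / 4)⁻¹ * (T / 4 *
            σ {x | T / 4 * K x < rieszPotential β ((σ.withDensity g).restrict A) x}) := by
          rw [← mul_assoc, ENNReal.inv_mul_cancel hT4' hT4, one_mul]
      _ ≤ (T / 4)⁻¹ * (N * σ.withDensity g A) := by gcongr
      _ = _ := by
          rw [ENNReal.inv_div (by simp) (by simp), div_eq_mul_inv]
          ring
  have hpt : ∀ t : ℝ, 0 < t →
      ENNReal.ofReal (p * t ^ (p - 1)) * σ {x | ENNReal.ofReal t ≤ v x / K x} ≤
      4 * N * ENNReal.ofReal (p / (p - 1)) * (ENNReal.ofReal ((p - 1) * t ^ (p - 1 - 1)) *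
        σ.withDensity g {x | ENNReal.ofReal t ≤ 2 * g x}) := by
    intro t ht
    refine (mul_le_mul_right (hlevel t ht) _).trans (le_of_eq ?_)
    have : ENNReal.ofReal (p * t ^ (p - 1)) * (ENNReal.ofReal t)⁻¹ =
        ENNReal.ofReal (p / (p - 1)) * ENNReal.ofReal ((p - 1) * t ^ (p - 1 - 1)) := by
      rw [← ENNReal.ofReal_inv_of_pos ht, ← ENNReal.ofReal_mul (by positivity),
        ← ENNReal.ofReal_mul (by positivity), Real.rpow_sub_one ht.ne' (p - 1)]
      congr 1
      field_simp
    calc _ = 4 * N * (ENNReal.ofReal (p * t ^ (p - 1)) * (ENNReal.ofReal t)⁻¹) *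
          σ.withDensity g {x | ENNReal.ofReal t ≤ 2 * g x} := by ring
      _ = _ := by rw [this]; ring
  rw [lintegral_rpow_eq_lintegral_meas_ofReal_le (by fun_prop) (by linarith)]
  refine (setLIntegral_mono' measurableSet_Ioi hpt).trans (le_of_eq ?_)
  rw [lintegral_const_mul' _ _ hfin,
    ← lintegral_rpow_eq_lintegral_meas_ofReal_le (by fun_prop) hp0,
    lintegral_withDensity_eq_lintegral_mul _ hg (by fun_prop), mul_assoc _ (2 ^ (p - 1)),
    ← lintegral_const_mul (2 ^ (p - 1)) (by fun_prop)]
  congr 1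
  refine lintegral_congr fun x => ?_
  have hgp : g x ^ p = g x ^ (p - 1) * g x := by
    conv_lhs => rw [← sub_add_cancel p 1,
      ENNReal.rpow_add_of_nonneg _ _ hp0.le zero_le_one, ENNReal.rpow_one]
  rw [Pi.mul_apply, ENNReal.mul_rpow_of_nonneg _ _ hp0.le, hgp]
  ring

/-- The weighted norm inequality `‖I_β(f^q dσ)‖_s ≤ C ‖f‖_s^q` in `L^s(σ)`, for `0 < q < 1` and
`s > q`, if `I_β σ ∈ L^(s / (1 - q))(σ)`. -/
theorem exists_lintegral_rieszPotential_powMeasure_le (hβ : β < n) {q s : ℝ} (hq0 : 0 < q)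
    (hq1 : q < 1) (hs : q < s) [SFinite σ] (hK0 : ∀ x, rieszPotential β σ x ≠ 0)
    (hK : ∫⁻ x, rieszPotential β σ x ^ (s / (1 - q)) ∂σ ≠ ∞) :
    ∃ C : ℝ≥0∞, C ≠ ∞ ∧ ∀ f : EuclideanSpace ℝ (Fin n) → ℝ≥0∞, Measurable f →
      ∫⁻ x, rieszPotential β (powMeasure f q σ) x ^ s ∂σ ≤ C * (∫⁻ x, f x ^ s ∂σ) ^ q := by
  have hq1' : 0 < 1 - q := by linarith
  have hs0 : 0 < s := hq0.trans hs
  obtain ⟨C, hC, hCle⟩ :=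
    exists_lintegral_rieszPotential_div_rpow_le n (p := s / q) (by rwa [one_lt_div hq0])
  have hKm : Measurable (rieszPotential β σ) := measurable_rieszPotential β σ
  have hKt : ∀ᵐ x ∂σ, rieszPotential β σ x ≠ ∞ := by
    filter_upwards [ae_lt_top (hKm.pow_const _) hK] with x hx hxt
    rw [hxt, ENNReal.top_rpow_of_pos (by positivity)] at hx
    exact lt_irrefl _ hx
  refine ⟨C ^ q * (∫⁻ x, rieszPotential β σ x ^ (s / (1 - q)) ∂σ) ^ (1 - q),
    ENNReal.mul_ne_top (ENNReal.rpow_ne_top_of_nonneg hq0.le hC)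
      (ENNReal.rpow_ne_top_of_nonneg hq1'.le hK), fun f hf => ?_⟩
  have hM := hCle β hβ σ (fun y => f y ^ q) (hf.pow_const q) hK0 hKt
  change ∫⁻ x, (rieszPotential β (powMeasure f q σ) x / _) ^ _ ∂σ ≤ _ at hM
  have : SFinite (powMeasure f q σ) := by unfold powMeasure; infer_instance
  have hvm : Measurable (rieszPotential β (powMeasure f q σ)) := measurable_rieszPotential β _
  set v := rieszPotential β (powMeasure f q σ)
  set K := rieszPotential β σ
  have hconj : (q⁻¹).HolderConjugate (1 - q)⁻¹ := by
    rw [Real.holderConjugate_iff]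
    exact ⟨(one_lt_inv₀ hq0).2 hq1, by simp⟩
  have hf' : ∀ x, (f x ^ q) ^ (s / q) = f x ^ s := fun x => by
    rw [← ENNReal.rpow_mul, mul_div_cancel₀ _ hq0.ne']
  simp_rw [hf'] at hM
  -- Hölder with exponents `1/q` and `1/(1-q)` separates the quotient, bounded on `L^(s/q)(σ)`, from
  -- the assumed norm of `K`.
  calc ∫⁻ x, v x ^ s ∂σ = ∫⁻ x, ((fun x => (v x / K x) ^ s) * fun x => K x ^ s) x ∂σ := by
        refine lintegral_congr_ae ?_
        filter_upwards [hKt] with x hx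
        rw [Pi.mul_apply, ← ENNReal.mul_rpow_of_nonneg _ _ hs0.le,
          ENNReal.div_mul_cancel (hK0 x) hx]
    _ ≤ (∫⁻ x, ((v x / K x) ^ s) ^ q⁻¹ ∂σ) ^ (1 / q⁻¹) *
          (∫⁻ x, (K x ^ s) ^ (1 - q)⁻¹ ∂σ) ^ (1 / (1 - q)⁻¹) :=
        ENNReal.lintegral_mul_le_Lp_mul_Lq σ hconj (by fun_prop) (by fun_prop)
    _ = (∫⁻ x, (v x / K x) ^ (s / q) ∂σ) ^ q * (∫⁻ x, K x ^ (s / (1 - q)) ∂σ) ^ (1 - q) := by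
        simp_rw [← ENNReal.rpow_mul, ← div_eq_mul_inv, one_div, inv_inv]
    _ ≤ (C * ∫⁻ x, f x ^ s ∂σ) ^ q * (∫⁻ x, K x ^ (s / (1 - q)) ∂σ) ^ (1 - q) := by gcongr
    _ = _ := by rw [ENNReal.mul_rpow_of_nonneg _ _ hq0.le]; ring

end NormInequality

/-! ### Existence by monotone iteration. -/

section Existence

variable {n : ℕ} {β q : ℝ} {σ : Measure (EuclideanSpace ℝ (Fin n))}

theorem memLp_ofReal_iff {X : Type*} [MeasurableSpace X] {μ : Measure X} {f : X → ℝ≥0∞} {a : ℝ}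
    (ha : 0 < a) : MemLp f (ENNReal.ofReal a) μ ↔
      AEStronglyMeasurable f μ ∧ ∫⁻ x, f x ^ a ∂μ < ∞ := by
  rw [MemLp, eLpNorm_lt_top_iff_lintegral_rpow_enorm_lt_top (by simpa using ha)
    ENNReal.ofReal_ne_top, ENNReal.toReal_ofReal ha.le]
  simp only [enorm_eq_self]

theorem rieszPotential_ne_zero (hβ : β < n) (hσ : σ ≠ 0) (x : EuclideanSpace ℝ (Fin n)) :
    rieszPotential β σ x ≠ 0 := by
  intro h
  rw [rieszPotential, lintegral_eq_zero_iff (measurable_edist_rpow β x)] at h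
  refine hσ (Measure.measure_univ_eq_zero.1 ?_)
  refine measure_mono_null (fun y _ => ?_) (ae_iff.1 h)
  simp [ENNReal.rpow_eq_zero_iff, hβ.le]

instance sFinite_powMeasure [SFinite σ] (u : EuclideanSpace ℝ (Fin n) → ℝ≥0∞) :
    SFinite (powMeasure u q σ) := by
  unfold powMeasure; infer_instance

theorem rieszPotential_powMeasure {u : EuclideanSpace ℝ (Fin n) → ℝ≥0∞} (hu : Measurable u)
    (x : EuclideanSpace ℝ (Fin n)) :
    rieszPotential β (powMeasure u q σ) x = ∫⁻ y, u y ^ q * edist x y ^ (β - n) ∂σ :=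
  rieszPotential_withDensity (hu.pow_const q) x

theorem powMeasure_mono (hq : 0 ≤ q) {u v : EuclideanSpace ℝ (Fin n) → ℝ≥0∞} (h : u ≤ v) :
    powMeasure u q σ ≤ powMeasure v q σ :=
  withDensity_mono (Eventually.of_forall fun x => ENNReal.rpow_le_rpow (h x) hq)

theorem ENNReal.iSup_rpow_of_pos {ι : Sort*} {a : ℝ} (ha : 0 < a) (f : ι → ℝ≥0∞) :
    (⨆ i, f i) ^ a = ⨆ i, f i ^ a :=
  (ENNReal.orderIsoRpow a ha).map_iSup f

/-- A multiple of `(I_β σ)^(1 / (1 - q))` is a subsolution of `u = I_β(u^q dσ)`. -/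
theorem exists_mul_rieszPotential_rpow_le (hβ : β < n) (hq0 : 0 < q) (hq1 : q < 1) [SFinite σ] :
    ∃ c : ℝ≥0∞, c ≠ 0 ∧ c ≠ ∞ ∧ ∀ x, c * rieszPotential β σ x ^ (1 - q)⁻¹ ≤
      rieszPotential β (powMeasure (fun y => c * rieszPotential β σ y ^ (1 - q)⁻¹) q σ) x := by
  have hq1' : 0 < 1 - q := by linarith
  have ha : 0 < q / (1 - q) := by positivity
  set D : ℝ≥0∞ := 2 * (2 * 2 ^ (n - β)) ^ (q / (1 - q)) with hD
  have h2t : (2 : ℝ≥0∞) * 2 ^ (n - β) ≠ ∞ :=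
    ENNReal.mul_ne_top (by norm_num) (ENNReal.rpow_ne_top_of_nonneg (by linarith) (by norm_num))
  have hDt : D ≠ ∞ :=
    ENNReal.mul_ne_top (by norm_num) (ENNReal.rpow_ne_top_of_nonneg ha.le h2t)
  have hD0 : D ≠ 0 := by
    refine mul_ne_zero (by norm_num) ?_
    simp [ENNReal.rpow_eq_zero_iff, h2t]
  -- The solution of `c = c^q / D`, which balances the two homogeneities.
  set c : ℝ≥0∞ := D⁻¹ ^ (1 - q)⁻¹ with hc
  have hc0 : c ≠ 0 := by simp [hc, ENNReal.rpow_eq_zero_iff, hDt, hq1.le]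
  have hct : c ≠ ∞ := ENNReal.rpow_ne_top_of_nonneg (by positivity) (by simp [hD0])
  have hcD : c = c ^ q * D⁻¹ := by
    have : D⁻¹ = c ^ (1 - q) := by
      rw [hc, ← ENNReal.rpow_mul, inv_mul_cancel₀ hq1'.ne', ENNReal.rpow_one]
    rw [this, ← ENNReal.rpow_add _ _ hc0 hct, add_sub_cancel, ENNReal.rpow_one]
  have hKm : Measurable (rieszPotential β σ) := measurable_rieszPotential β σ
  refine ⟨c, hc0, hct, fun x => ?_⟩
  have hlow := rieszPotential_rpow_le (μ := σ) hβ ha x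
  rw [rieszPotential_withDensity (hKm.pow_const _), ← hD,
    show 1 + q / (1 - q) = (1 - q)⁻¹ by field_simp; ring] at hlow
  rw [rieszPotential_powMeasure (by fun_prop)]
  have hpow : ∀ y, (c * rieszPotential β σ y ^ (1 - q)⁻¹) ^ q * edist x y ^ (β - n) =
      c ^ q * (rieszPotential β σ y ^ (q / (1 - q)) * edist x y ^ (β - n)) := fun y => by
    rw [ENNReal.mul_rpow_of_nonneg _ _ hq0.le, ← ENNReal.rpow_mul (rieszPotential β σ y),
      show (1 - q)⁻¹ * q = q / (1 - q) by field_simp, mul_assoc]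
  simp_rw [hpow]
  rw [lintegral_const_mul _ (by fun_prop)]
  calc c * rieszPotential β σ x ^ (1 - q)⁻¹
      = c ^ q * (D⁻¹ * rieszPotential β σ x ^ (1 - q)⁻¹) := by rw [← mul_assoc, ← hcD]
    _ ≤ c ^ q * (D⁻¹ * (D * _)) := by gcongr
    _ = _ := by rw [← mul_assoc D⁻¹, ENNReal.inv_mul_cancel hD0 hDt, one_mul]

/-- If `I_β σ ∈ L^(s / (1 - q))(σ)`, then `u = I_β(u^q dσ)` has a positive solution
in `L^s(σ)`. -/
theorem exists_eq_rieszPotential_powMeasure (hβ : β < n) (hq0 : 0 < q) (hq1 : q < 1) {s : ℝ}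
    (hs : q < s) [SFinite σ] (hσ : σ ≠ 0)
    (hK : ∫⁻ x, rieszPotential β σ x ^ (s / (1 - q)) ∂σ ≠ ∞) :
    ∃ u : EuclideanSpace ℝ (Fin n) → ℝ≥0∞, Measurable u ∧
      (∀ x, u x = rieszPotential β (powMeasure u q σ) x) ∧ (∀ x, 0 < u x) ∧
      ∫⁻ x, u x ^ s ∂σ < ∞ := by
  have hq1' : 0 < 1 - q := by linarith
  have hs0 : 0 < s := hq0.trans hs
  have hK0 := rieszPotential_ne_zero hβ hσ
  have hKm : Measurable (rieszPotential β σ) := measurable_rieszPotential β σ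
  obtain ⟨c, hc0, hct, hsub⟩ := exists_mul_rieszPotential_rpow_le (σ := σ) hβ hq0 hq1
  obtain ⟨C, hC, hnorm⟩ :=
    exists_lintegral_rieszPotential_powMeasure_le hβ hq0 hq1 hs hK0 hK
  set u₀ := fun y => c * rieszPotential β σ y ^ (1 - q)⁻¹ with hu₀
  obtain ⟨U, hU0, hUsucc⟩ : ∃ U : ℕ → EuclideanSpace ℝ (Fin n) → ℝ≥0∞, U 0 = u₀ ∧
      ∀ j, U (j + 1) = rieszPotential β (powMeasure (U j) q σ) :=
    ⟨fun j => (fun f => rieszPotential β (powMeasure f q σ))^[j] u₀, rfl,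
      fun j => Function.iterate_succ_apply' _ j u₀⟩
  have hUm : ∀ j, Measurable (U j) := by
    intro j
    cases j with
    | zero => rw [hU0]; exact (hKm.pow_const _).const_mul c
    | succ j => rw [hUsucc]; exact measurable_rieszPotential β _
  have hmono : Monotone U := by
    refine monotone_nat_of_le_succ fun j => ?_
    induction j with
    | zero => rw [hUsucc, hU0]; exact hsub
    | succ j ih =>
      rw [hUsucc (j + 1)]
      nth_rw 1 [hUsucc j]
      exact fun x => rieszPotential_mono (powMeasure_mono hq0.le ih) x
  have hu₀int : ∫⁻ x, u₀ x ^ s ∂σ ≠ ∞ := by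
    have : ∀ x, u₀ x ^ s = c ^ s * rieszPotential β σ x ^ (s / (1 - q)) := fun x => by
      simp only [hu₀]
      rw [ENNReal.mul_rpow_of_nonneg _ _ hs0.le, ← ENNReal.rpow_mul, div_eq_inv_mul]
    rw [lintegral_congr this, lintegral_const_mul _ (hKm.pow_const _)]
    exact ENNReal.mul_ne_top (ENNReal.rpow_ne_top_of_nonneg hs0.le hct) hK
  -- `B ≥ C^(1/(1-q))` is what makes `C B^q ≤ B`, so the bound `B` survives each iteration.
  set B := max (∫⁻ x, u₀ x ^ s ∂σ) (C ^ (1 - q)⁻¹) with hB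
  have hBt : B < ∞ := max_lt hu₀int.lt_top (ENNReal.rpow_lt_top_of_nonneg (by positivity) hC)
  have hCB : C * B ^ q ≤ B := by
    have h1 : C ≤ B ^ (1 - q) := by
      calc C = (C ^ (1 - q)⁻¹) ^ (1 - q) := by
            rw [← ENNReal.rpow_mul, inv_mul_cancel₀ hq1'.ne', ENNReal.rpow_one]
        _ ≤ _ := ENNReal.rpow_le_rpow (le_max_right _ _) hq1'.le
    calc C * B ^ q ≤ B ^ (1 - q) * B ^ q := by gcongr
      _ = B := by
        rw [← ENNReal.rpow_add_of_nonneg _ _ hq1'.le hq0.le, sub_add_cancel, ENNReal.rpow_one]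
  have hbound : ∀ j, ∫⁻ x, U j x ^ s ∂σ ≤ B := by
    intro j
    induction j with
    | zero => rw [hU0]; exact le_max_left _ _
    | succ j ih =>
      rw [hUsucc]
      refine (hnorm _ (hUm j)).trans (le_trans ?_ hCB)
      gcongr
  have hum : Measurable fun x => ⨆ j, U j x := Measurable.iSup hUm
  refine ⟨fun x => ⨆ j, U j x, hum, fun x => ?_, fun x => ?_, ?_⟩
  · rw [rieszPotential_powMeasure hum]
    simp_rw [ENNReal.iSup_rpow_of_pos hq0, ENNReal.iSup_mul]
    rw [lintegral_iSup (f := fun j y => U j y ^ q * edist x y ^ (β - n))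
      (fun j => ((hUm j).pow_const q).mul (measurable_edist_rpow β x))]
    · rw [← Monotone.iSup_nat_add (f := fun j => U j x) (fun i j hij => hmono hij x) 1]
      refine iSup_congr fun j => ?_
      rw [hUsucc, rieszPotential_powMeasure (hUm j)]
    · intro i j hij y
      have := hmono hij y
      dsimp only
      gcongr
  · refine lt_of_lt_of_le ?_ (le_iSup (fun j => U j x) 0)
    rw [hU0]
    refine pos_iff_ne_zero.2 (mul_ne_zero hc0 ?_)
    simp [ENNReal.rpow_eq_zero_iff, hK0 x, hq1.le]
  · simp_rw [ENNReal.iSup_rpow_of_pos hs0]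
    rw [lintegral_iSup fun j => (hUm j).pow_const s]
    · exact (iSup_le hbound).trans_lt hBt
    · intro i j hij y
      have := hmono hij y
      dsimp only
      gcongr

theorem memLpLoc_of_lintegral_rpow_lt_top [IsLocallyFiniteMeasure σ]
    {u : EuclideanSpace ℝ (Fin n) → ℝ≥0∞} (hu : Measurable u) {s : ℝ} (hq0 : 0 < q) (hs : q ≤ s)
    (h : ∫⁻ x, u x ^ s ∂σ < ∞) : MemLpLoc u q σ := by
  intro S hS
  refine (memLp_ofReal_iff hq0).2 ⟨hu.aestronglyMeasurable, ?_⟩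
  have hle : ∀ x, u x ^ q ≤ 1 + u x ^ s := by
    intro x
    rcases le_total (u x) 1 with h1 | h1
    · exact (ENNReal.rpow_le_one h1 hq0.le).trans le_self_add
    · exact (ENNReal.rpow_le_rpow_of_exponent_le h1 hs).trans le_add_self
  calc ∫⁻ x in S, u x ^ q ∂σ ≤ ∫⁻ x in S, (1 + u x ^ s) ∂σ := lintegral_mono hle
    _ = σ S + ∫⁻ x in S, u x ^ s ∂σ := by
        rw [lintegral_add_left measurable_const, setLIntegral_one]
    _ ≤ σ S + ∫⁻ x, u x ^ s ∂σ := by gcongr; exact Measure.restrict_le_self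
    _ < ∞ := ENNReal.add_lt_top.2 ⟨hS.measure_lt_top, h⟩

/-- Otherwise `u` exceeds a positive constant off a compact set, hence on a set of infinite volume,
against Markov's inequality. -/
theorem liminf_cocompact_eq_zero (hn : n ≠ 0) {u : EuclideanSpace ℝ (Fin n) → ℝ≥0∞}
    (hu : Measurable u) {r : ℝ} (hr : 0 < r) (h : ∫⁻ x, u x ^ r < ∞) :
    liminf u (cocompact (EuclideanSpace ℝ (Fin n))) = 0 := by
  by_contra hne
  obtain ⟨c, hc0, hc⟩ := exists_between (pos_iff_ne_zero.2 hne)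
  have hev := eventually_lt_of_lt_liminf hc
  obtain ⟨S, hS, hSc⟩ := mem_cocompact.1 hev
  have : Nonempty (Fin n) := ⟨⟨0, Nat.pos_of_ne_zero hn⟩⟩
  have hct : c ≠ ∞ := ne_top_of_lt hc
  have hvol : volume (Sᶜ) = ∞ := by
    rw [measure_compl hS.measurableSet hS.measure_lt_top.ne,
      measure_univ_of_isAddLeftInvariant, ENNReal.top_sub hS.measure_lt_top.ne]
  have hmarkov := mul_meas_ge_le_lintegral (μ := volume) (hu.pow_const r) (c ^ r)
  have : volume {x | c ^ r ≤ u x ^ r} = ∞ := by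
    rw [← top_le_iff, ← hvol]
    refine measure_mono fun x hx => ?_
    have hx' : c < u x := hSc hx
    exact ENNReal.rpow_le_rpow hx'.le hr.le
  rw [this, ENNReal.mul_top (by simp [ENNReal.rpow_eq_zero_iff, hc0.ne', hct])] at hmarkov
  exact absurd (hmarkov.trans_lt h) (lt_irrefl _)

end Existence

/-! ### Nonexistence for small exponents. -/

section Nonexistence

variable {n : ℕ} {β q : ℝ} {σ : Measure (EuclideanSpace ℝ (Fin n))}

/-- In polar coordinates the radial integrand `y^(n-1) (y+R)^(-a)` is at least `2^(-n) / y` for `y >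
R`, which diverges logarithmically. -/
theorem lintegral_norm_add_rpow_eq_top (hn : n ≠ 0) {R a : ℝ} (hR : 1 ≤ R) (ha : a ≤ n) :
    ∫⁻ x : EuclideanSpace ℝ (Fin n), ENNReal.ofReal ((‖x‖ + R) ^ (-a)) = ∞ := by
  by_contra hfin
  have hpos : ∀ x : EuclideanSpace ℝ (Fin n), 0 < ‖x‖ + R := fun x => by positivity
  have hcont : Continuous fun x : EuclideanSpace ℝ (Fin n) => (‖x‖ + R) ^ (-a) :=
    (continuous_norm.add continuous_const).rpow_const fun x => Or.inl (hpos x).ne'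
  have hint : Integrable fun x : EuclideanSpace ℝ (Fin n) => (‖x‖ + R) ^ (-a) :=
    ⟨hcont.aestronglyMeasurable, (hasFiniteIntegral_iff_ofReal (Eventually.of_forall fun x =>
      Real.rpow_nonneg (hpos x).le _)).2 (lt_top_iff_ne_top.2 hfin)⟩
  have : Nonempty (Fin n) := ⟨⟨0, Nat.pos_of_ne_zero hn⟩⟩
  rw [integrable_fun_norm_addHaar volume (f := fun y : ℝ => (y + R) ^ (-a))] at hint
  have hint' := hint.mono_set (Set.Ioi_subset_Ioi (show (0 : ℝ) ≤ R by linarith))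
  refine not_integrableOn_Ioi_inv (a := R) ?_
  refine Integrable.mono' (hint'.const_mul (2 ^ n)) (by fun_prop) ?_
  filter_upwards [ae_restrict_mem measurableSet_Ioi] with y hy
  have hRy : R < y := hy
  have hy0 : 0 < y := by linarith
  rw [finrank_euclideanSpace_fin, Real.norm_of_nonneg (by positivity), smul_eq_mul]
  have h1 : (y + R) ^ (-(n : ℝ)) ≤ (y + R) ^ (-a) :=
    Real.rpow_le_rpow_of_exponent_le (by linarith) (by linarith)
  have h2 : (2 * y) ^ (-(n : ℝ)) ≤ (y + R) ^ (-(n : ℝ)) :=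
    Real.rpow_le_rpow_of_nonpos (by linarith) (by linarith) (by simp)
  have h3 : y⁻¹ = 2 ^ n * (y ^ (n - 1) * (2 * y) ^ (-(n : ℝ))) := by
    obtain ⟨k, rfl⟩ := Nat.exists_eq_succ_of_ne_zero hn
    rw [Real.rpow_neg (by positivity), Real.rpow_natCast, mul_pow, Nat.succ_sub_one, pow_succ y]
    field_simp
  rw [h3]
  gcongr
  exact h2.trans h1

/-- The Riesz potential of a nonzero measure is not in `L^r` for `r ≤ n / (n - β)`. -/
theorem lintegral_rieszPotential_rpow_eq_top (hβ0 : 0 < β) (hβ : β < n) {r : ℝ} (hr0 : 0 < r)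
    (hr : r ≤ n / (n - β)) {ω : Measure (EuclideanSpace ℝ (Fin n))} (hω : ω ≠ 0) :
    ∫⁻ x, rieszPotential β ω x ^ r = ∞ := by
  have h0 : (0 : ℝ) < n - β := by linarith
  have hn : n ≠ 0 := by
    rintro rfl
    simp at hβ
    linarith
  obtain ⟨k, hk⟩ : ∃ k : ℕ, ω (Metric.closedBall 0 k) ≠ 0 := by
    by_contra! hcon
    refine hω (Measure.measure_univ_eq_zero.1 ?_)
    rw [← Metric.iUnion_closedBall_nat 0]
    exact measure_iUnion_null hcon
  set m := ω (Metric.closedBall 0 k)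
  set R : ℝ := k + 1
  have hR : 1 ≤ R := by simp [R]
  have hlow : ∀ x, ENNReal.ofReal ((‖x‖ + R) ^ (-(n - β))) * m ≤ rieszPotential β ω x := by
    intro x
    calc _ = ∫⁻ _ in Metric.closedBall 0 k, ENNReal.ofReal ((‖x‖ + R) ^ (-(n - β))) ∂ω := by
          rw [setLIntegral_const]
      _ ≤ ∫⁻ y in Metric.closedBall 0 k, edist x y ^ (β - n) ∂ω := by
          refine setLIntegral_mono' measurableSet_closedBall fun y hy => ?_
          rw [← ENNReal.ofReal_rpow_of_pos (by positivity), neg_sub]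
          refine ENNReal.rpow_le_rpow_of_neg (by linarith) ?_
          rw [edist_dist]
          refine ENNReal.ofReal_le_ofReal ((dist_le_norm_add_norm x y).trans ?_)
          have := mem_closedBall_zero_iff.1 hy
          simp only [R]
          linarith
      _ ≤ _ := setLIntegral_le_lintegral _ _
  have hm0 : m ^ r ≠ 0 := by
    intro h
    rcases ENNReal.rpow_eq_zero_iff.1 h with h | h
    · exact hk h.1
    · linarith [h.2]
  rw [← top_le_iff]
  have hexp : (n - β) * r ≤ n := by
    rw [le_div_iff₀ h0] at hr
    linarith
  calc ∞ = (∫⁻ x : EuclideanSpace ℝ (Fin n),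
        ENNReal.ofReal ((‖x‖ + R) ^ (-((n - β) * r)))) * m ^ r := by
        rw [lintegral_norm_add_rpow_eq_top hn hR hexp, ENNReal.top_mul hm0]
    _ = ∫⁻ x : EuclideanSpace ℝ (Fin n),
        ENNReal.ofReal ((‖x‖ + R) ^ (-((n - β) * r))) * m ^ r :=
        (lintegral_mul_const _ (by fun_prop)).symm
    _ ≤ _ := by
        refine lintegral_mono fun x => ?_
        refine le_trans (le_of_eq ?_) (ENNReal.rpow_le_rpow (hlow x) hr0.le)
        rw [ENNReal.mul_rpow_of_nonneg _ _ hr0.le, ENNReal.ofReal_rpow_of_pos (by positivity),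
          ← Real.rpow_mul (by positivity), neg_mul]

/-- Needed to deduce `u = 0` `σ`-a.e. from `u^q dσ = 0`. -/
theorem MemLpLoc.aemeasurable {u : EuclideanSpace ℝ (Fin n) → ℝ≥0∞} (h : MemLpLoc u q σ) :
    AEMeasurable u σ := by
  rw [← Measure.restrict_univ (μ := σ), ← Metric.iUnion_closedBall_nat 0, aemeasurable_iUnion_iff]
  exact fun k => (h _ (isCompact_closedBall 0 k)).1.aemeasurable

/-- The common core of the nonexistence claims, with `ω` either `u^q dσ` or the measure representing
`u`. -/
theorem eq_zero_of_rieszPotential_le_of_memLp (hβ0 : 0 < β) (hβ : β < n) {r : ℝ} (hr0 : 0 < r)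
    (hr : r ≤ n / (n - β)) {ω : Measure (EuclideanSpace ℝ (Fin n))}
    {u : EuclideanSpace ℝ (Fin n) → ℝ≥0∞} (hu : MemLp u (ENNReal.ofReal r) volume)
    (hle : ∀ x, rieszPotential β ω x ≤ u x) : ω = 0 := by
  by_contra hω
  have h1 := ((memLp_ofReal_iff hr0).1 hu).2
  have h2 : ∫⁻ x, rieszPotential β ω x ^ r ≤ ∫⁻ x, u x ^ r :=
    lintegral_mono fun x => ENNReal.rpow_le_rpow (hle x) hr0.le
  rw [lintegral_rieszPotential_rpow_eq_top hβ0 hβ hr0 hr hω] at h2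
  exact absurd (h2.trans_lt h1) (lt_irrefl _)

end Nonexistence

/-! ### The main theorem. -/

theorem theorem1p4 (n : ℕ) (q α r : ℝ) (hq0 : 0 < q) (hq1 : q < 1)
    (hα0 : 0 < α) (hαn : α < (n : ℝ) / 2) (hr : 0 < r)
    (σ : Measure (EuclideanSpace ℝ (Fin n))) [IsLocallyFiniteMeasure σ] (hσ : σ ≠ 0) :
    ((n : ℝ) / (n - 2 * α) < r →
      ∀ γ : ℝ, γ = (r * (n - 2 * α) - n) / n →
      MemLp (rieszPotential (2 * α) σ) (ENNReal.ofReal ((γ + q) / (1 - q))) σ →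
      ∃ u : EuclideanSpace ℝ (Fin n) → ℝ≥0∞,
        IsSolution α q σ u ∧ (∀ x, 0 < u x) ∧
        MemLp u (ENNReal.ofReal r) volume ∧
        liminf u (cocompact (EuclideanSpace ℝ (Fin n))) = 0) ∧
    (r ≤ (n : ℝ) / (n - 2 * α) →
      ∀ u : EuclideanSpace ℝ (Fin n) → ℝ≥0∞, MemLp u (ENNReal.ofReal r) volume →
        (IsSupersolution α q σ u → u =ᵐ[σ] 0) ∧
        (IsPotentialSupersolution α q σ u → ∀ x, u x = 0) ∧
        (IsSolution α q σ u → ∀ x, u x = 0)) := by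
  have hβ0 : 0 < 2 * α := by linarith
  have hβ : 2 * α < n := by linarith
  have h0 : (0 : ℝ) < n - 2 * α := by linarith
  have hn0 : (0 : ℝ) < n := by linarith
  have hn : n ≠ 0 := by exact_mod_cast hn0.ne'
  refine ⟨fun hrn γ hγ hK => ?_, fun hrn u hu => ⟨fun hsol => ?_, fun hsol => ?_, fun hsol => ?_⟩⟩
  · have hγ0 : 0 < γ := by
      rw [hγ]
      rw [div_lt_iff₀ h0] at hrn
      exact div_pos (by linarith) hn0
    have hs : q < γ + q := by linarith
    have hs0 : 0 < (γ + q) / (1 - q) := div_pos (by linarith) (by linarith)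
    obtain ⟨u, hum, hueq, hupos, hus⟩ := exists_eq_rieszPotential_powMeasure hβ hq0 hq1 hs hσ
      ((memLp_ofReal_iff hs0).1 hK).2.ne
    have hfun : rieszPotential (2 * α) (powMeasure u q σ) = u := funext fun x => (hueq x).symm
    have henergy : ∫⁻ x, rieszPotential (2 * α) (powMeasure u q σ) x ^ γ ∂(powMeasure u q σ) ≠
        ∞ := by
      rw [hfun, powMeasure, lintegral_withDensity_eq_lintegral_mul _ (hum.pow_const q)
        (hum.pow_const γ)]
      refine ne_of_lt (lt_of_le_of_lt (le_of_eq (lintegral_congr fun x => ?_)) hus)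
      rw [Pi.mul_apply, add_comm, ENNReal.rpow_add_of_nonneg _ _ hq0.le hγ0.le]
    -- The definition of `γ`, solved for `r`, reads `r = (1 + γ) n / (n - 2α)`.
    have hur := lintegral_rieszPotential_rpow_lt_top hβ0 hβ hγ0 (r := r)
      (by rw [hγ]; field_simp; ring) henergy
    rw [hfun] at hur
    exact ⟨u, ⟨memLpLoc_of_lintegral_rpow_lt_top hum hq0 hs.le hus, hueq⟩, hupos,
      (memLp_ofReal_iff hr).2 ⟨hum.aestronglyMeasurable, hur⟩,
      liminf_cocompact_eq_zero hn hum hr hur⟩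
  · have h := eq_zero_of_rieszPotential_le_of_memLp hβ0 hβ hr hrn hu hsol.potential_le
    rw [powMeasure, withDensity_eq_zero_iff (hsol.memLpLoc.aemeasurable.pow_const q)] at h
    filter_upwards [h] with x hx
    exact (ENNReal.rpow_eq_zero_iff_of_pos hq0).1 hx
  · obtain ⟨ω, -, -, heq⟩ := hsol.exists_measure
    have h := eq_zero_of_rieszPotential_le_of_memLp hβ0 hβ hr hrn hu fun x => (heq x).ge
    exact fun x => by rw [heq x, h]; simp [rieszPotential]
  · have h := eq_zero_of_rieszPotential_le_of_memLp hβ0 hβ hr hrn hu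
      fun x => (hsol.eq_potential x).ge
    exact fun x => by rw [hsol.eq_potential x, h]; simp [rieszPotential]
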